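/- Let $G$ be a countably infinite (discrete) group. Then there is an action of $G$ by homeomorphisms on a totally disconnected locally compact Hausdorff space $X$ that is neither discrete nor compact, such that the action is free (if $g.x = x$ for some $x \in X$, then $g = e$) and minimal (every orbit is dense in $X$). If $G$ is exact, then $X$ and the action can moreover be chosen such that the action is amenable. Here the action of $G$ on $X$ is called amenable if there is a net of continuous maps $m_i \colon X \to \mathrm{Prob}(G)$ such that for each $s \in G$ and each compact $K \subseteq X$ one has $\lim_i \sup_{x \in K} \| s.m_i(x) - m_i(s.x) \|_1 = 0$, where $\mathrm{Prob}(G) \subseteq \ell^1(G)$ is the set of probability measures on $G$ (with the topology of pointwise convergence, which is that of the $\ell^1$-norm) and $(s.p)(g) = p(s^{-1}g)$. The group $G$ is called exact if its reduced group $C^*$-algebra $C^*_\lambda(G) \subseteq B(\ell^2(G))$ (the $C^*$-algebra generated by the left regular representation) is exact. A $C^*$-algebra $A$ is called exact if there are a Hilbert space $H$ and an injective $^*$-homomorphism $\pi \colon A \to B(H)$ that is nuclear, i.e., such that there are nets of contractive completely positive maps $\varphi_i \colon A \to M_{n(i)}(\mathbb{C})$ and $\psi_i \colon M_{n(i)}(\mathbb{C})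 \to B(H)$ with $\|\psi_i(\varphi_i(a)) - \pi(a)\| \to 0$ for every $a \in A$. -/

import Mathlib

open scoped CStarAlgebra ComplexOrder ENNReal

universe u v

noncomputable section

/-- A topological action of the (discrete) group `G` on the locally compact space `X` is
*amenable* if there is a net of continuous maps `m i : X → Prob G` such that, for each `s : G`,
`‖s • m i x - m i (s • x)‖₁ → 0` uniformly for `x` in compact subsets of `X`.

The net is indexed by the triples `(F, K, ε)`. An element of `Prob G` is a function `G → ℝ` that is
non-negative with sum `1`; on `Prob G` the topology of pointwise convergence (the weak-* topology)
is that of the `ℓ¹`-norm. The group acts on `Prob G` by `(s • p) g = p (s⁻¹ * g)`. -/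
def IsAmenableAction (G : Type u) (X : Type v) [Group G] [TopologicalSpace X] [MulAction G X] :
    Prop :=
  ∀ (F : Finset G) (K : Set X), IsCompact K → ∀ ε : ℝ, 0 < ε →
    ∃ m : X → G → ℝ,
      (∀ g, Continuous fun x => m x g) ∧
      (∀ x g, 0 ≤ m x g) ∧
      (∀ x, HasSum (m x) 1) ∧
      ∀ s ∈ F, ∀ x ∈ K, ∑' g, |m x (s⁻¹ * g) - m (s • x) g| < ε

/-- A map `θ` between C⋆-algebras is *nuclear* if it is a limit, in the topology of pointwise norm
convergence, of maps of the form `ψ ∘ φ` where `φ : A → Mₙ(ℂ)` and `ψ : Mₙ(ℂ) → B` are contractive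
completely positive maps. -/
def IsNuclearMap {A : Type u} {B : Type v} [NonUnitalCStarAlgebra A] [PartialOrder A]
    [StarOrderedRing A] [NonUnitalCStarAlgebra B] [PartialOrder B] [StarOrderedRing B]
    (θ : A → B) : Prop :=
  ∀ (F : Finset A) (ε : ℝ), 0 < ε →
    ∃ (n : ℕ) (φ : A →CP CStarMatrix (Fin n) (Fin n) ℂ)
      (ψ : CStarMatrix (Fin n) (Fin n) ℂ →CP B),
      (∀ a, ‖φ a‖ ≤ ‖a‖) ∧ (∀ b, ‖ψ b‖ ≤ ‖b‖) ∧ ∀ a ∈ F, ‖ψ (φ a) - θ a‖ < ε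

/-- A C⋆-algebra is *exact* if it has a faithful representation on a Hilbert space that is nuclear
as a map into the algebra of all bounded operators. The order on `A` is the canonical one, whose
non-negative elements are the positive elements of the C⋆-algebra. -/
def IsExactCStarAlgebra (A : Type u) [CStarAlgebra A] : Prop :=
  letI : PartialOrder A := CStarAlgebra.spectralOrder A
  haveI : StarOrderedRing A := CStarAlgebra.spectralOrderedRing A
  ∃ (H : Type u) (_ : NormedAddCommGroup H) (_ : InnerProductSpace ℂ H) (_ : CompleteSpace H)
    (π : A →⋆ₙₐ[ℂ] (H →L[ℂ] H)), Function.Injective π ∧ IsNuclearMap π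

namespace LeftRegular

variable {G : Type u} [Group G]

lemma memℓp_translate (g : G) (f : lp (fun _ : G => ℂ) 2) :
    Memℓp (fun h : G => f (g⁻¹ * h)) 2 := by
  refine memℓp_gen ?_
  exact (Equiv.mulLeft g⁻¹).summable_iff.mpr ((lp.memℓp f).summable (by norm_num))

/-- The left regular representation of `G` on `ℓ²(G)`: `(λ(g) f)(h) = f (g⁻¹ h)`. -/
def rep (g : G) : lp (fun _ : G => ℂ) 2 →ₗᵢ[ℂ] lp (fun _ : G => ℂ) 2 where
  toFun f := ⟨fun h => f (g⁻¹ * h), memℓp_translate g f⟩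
  map_add' _ _ := rfl
  map_smul' _ _ := rfl
  norm_map' f := by
    rw [lp.norm_eq_tsum_rpow (by norm_num), lp.norm_eq_tsum_rpow (by norm_num)]
    congr 1
    exact (Equiv.mulLeft g⁻¹).tsum_eq fun h => ‖f h‖ ^ (2 : ℝ≥0∞).toReal

end LeftRegular

/-- The reduced group C⋆-algebra: the norm-closed ⋆-subalgebra of `B(ℓ²(G))` generated by the
operators of the left regular representation. -/
def reducedGroupCStarAlgebra (G : Type u) [Group G] :
    StarSubalgebra ℂ (lp (fun _ : G => ℂ) 2 →L[ℂ] lp (fun _ : G => ℂ) 2) :=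
  (StarAlgebra.adjoin ℂ
    (Set.range fun g : G => (LeftRegular.rep g).toContinuousLinearMap)).topologicalClosure

instance reducedGroupCStarAlgebra.isClosed (G : Type u) [Group G] :
    IsClosed (reducedGroupCStarAlgebra G :
      Set (lp (fun _ : G => ℂ) 2 →L[ℂ] lp (fun _ : G => ℂ) 2)) :=
  StarSubalgebra.isClosed_topologicalClosure _

/-- A discrete group is *exact* if its reduced group C⋆-algebra is exact. -/
def IsExactGroup (G : Type u) [Group G] : Prop :=
  IsExactCStarAlgebra (reducedGroupCStarAlgebra G)

end

/-! ### Thin but recurrent subsets of a countably infinite group -/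

section SparseSet

variable {G : Type u} [Group G]

/-! The space `X` is a locally closed invariant piece of the space of ultrafilters on `G`, on which
left translation is always free (`eq_one_of_smul_ultrafilter_eq`). A set `A ⊆ G` cuts out the piece.
Among the closed invariant sets meeting the clopen set of ultrafilters containing `A`, take a
minimal one `Y`, and keep the points of `Y` whose orbit meets this clopen set. The orbit closure of
such a point is again in the family, so it is `Y`; hence the action is minimal. Recurrence of `A`
yields arbitrarily many orbit points inside a compact set, which rules out discreteness. Thinness of
`A` prevents finitely many translates of the clopen set from covering the piece, which rules out
compactness (`exists_thin_recurrent_set`, `exists_minimal_invariant_ultrafilters`).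

For amenability, exactness has to give almost equivariant maps from `G` to probability measures on
one finite set (`HasFiniteApproxMeans`); these extend coordinatewise to ultrafilters and restrict to
`X`. In a nuclear factorization `ψ ∘ φ`, a Hahn–Banach argument replaces `φ` on finitely many group
elements by coefficients of finitely supported vectors (`exists_finite_coefficients_approx`), and
positivity of the Choi matrix turns `ψ` into Hilbert space operators (`exists_choi_factorization`).
Together they send an orbit of unit vectors in the representation space to finitely supported
Hilbert space valued functions with correlations near `1`; their normalized squared norms are the
measures. -/

lemma exists_notMem_image_mul_inv [Infinite G] (P F : Finset G) :
    ∃ g : G, ∀ f ∈ F, ∀ f' ∈ F, ∀ p ∈ P, ∀ q ∈ P, f * (p * q⁻¹) * f'⁻¹ ≠ g := by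
  classical
  obtain ⟨g, hg⟩ := Infinite.exists_notMem_finset
    (((F ×ˢ F) ×ˢ (P ×ˢ P)).image fun t => t.1.1 * (t.2.1 * t.2.2⁻¹) * t.1.2⁻¹)
  refine ⟨g, fun f hf f' hf' p hp q hq h => hg (Finset.mem_image.2 ⟨((f, f'), (p, q)), ?_, h⟩)⟩
  simp [hf, hf', hp, hq]

open Classical in
/-- A finite set `P` can be enlarged to `P ∪ P x` while its quotient set `P P⁻¹` keeps avoiding
`B` and starts avoiding a set of the form `F⁻¹ g F`. -/
lemma exists_union_image_mul_right [Infinite G] (P B F : Finset G)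
    (h : ∀ p ∈ P, ∀ q ∈ P, p * q⁻¹ ∉ B) :
    ∃ (x g : G) (B' : Finset G), B ⊆ B' ∧ (∀ f ∈ F, ∀ f' ∈ F, f⁻¹ * g * f' ∈ B') ∧
      Disjoint P (P.image (· * x)) ∧
      ∀ p ∈ P ∪ P.image (· * x), ∀ q ∈ P ∪ P.image (· * x), p * q⁻¹ ∉ B' := by
  obtain ⟨g, hg⟩ := exists_notMem_image_mul_inv P F
  set B' : Finset G := B ∪ (F ×ˢ F).image fun t => t.1⁻¹ * g * t.2 with hB'
  have h' : ∀ p ∈ P, ∀ q ∈ P, p * q⁻¹ ∉ B' := by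
    intro p hp q hq hpq
    rcases Finset.mem_union.1 hpq with hpq | hpq
    · exact h p hp q hq hpq
    · obtain ⟨⟨f, f'⟩, hf, e⟩ := Finset.mem_image.1 hpq
      rw [Finset.mem_product] at hf
      refine hg f hf.1 f' hf.2 p hp q hq ?_
      rw [← e]
      group
  -- The first two excluded sets keep the mixed quotients `(p x) q⁻¹` and `p (q x)⁻¹` out of `B'`,
  -- the third keeps `P x` disjoint from `P`. Quotients within `P x` are quotients within `P`.
  obtain ⟨x, hx⟩ := Infinite.exists_notMem_finset
    ((((P ×ˢ P) ×ˢ B').image fun t => t.1.1⁻¹ * t.2 * t.1.2) ∪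
      (((P ×ˢ P) ×ˢ B').image fun t => t.1.1⁻¹ * t.2⁻¹ * t.1.2) ∪
      (P ×ˢ P).image fun t => t.1⁻¹ * t.2)
  simp only [Finset.mem_union, Finset.mem_image, Finset.mem_product, Prod.exists, not_or,
    not_exists, not_and] at hx
  obtain ⟨⟨hx1, hx2⟩, hx3⟩ := hx
  refine ⟨x, g, B', Finset.subset_union_left, fun f hf f' hf' => ?_, ?_, ?_⟩
  · refine Finset.mem_union_right _ (Finset.mem_image.2 ⟨(f, f'), ?_, rfl⟩)
    simp [hf, hf']
  · rw [Finset.disjoint_left]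
    intro p hp hp'
    obtain ⟨q, hq, rfl⟩ := Finset.mem_image.1 hp'
    exact hx3 q (q * x) ⟨hq, hp⟩ (by group)
  · intro p hp q hq hpq
    rcases Finset.mem_union.1 hp with hp | hp <;> rcases Finset.mem_union.1 hq with hq | hq
    · exact h' p hp q hq hpq
    · obtain ⟨q, hq₀, rfl⟩ := Finset.mem_image.1 hq
      exact hx2 q p _ ⟨⟨hq₀, hp⟩, hpq⟩ (by group)
    · obtain ⟨p, hp₀, rfl⟩ := Finset.mem_image.1 hp
      exact hx1 p q _ ⟨⟨hp₀, hq⟩, hpq⟩ (by group)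
    · obtain ⟨q, hq₀, rfl⟩ := Finset.mem_image.1 hq
      obtain ⟨p, hp₀, rfl⟩ := Finset.mem_image.1 hp
      refine h' p hp₀ q hq₀ ?_
      convert hpq using 1
      group

/-- A countably infinite group contains a non-empty subset `A` each point of which has, in
finitely many prescribed directions, many translates in `A`, while `A` is so thin that any finite
union of its translates can be moved off itself. -/
theorem exists_thin_recurrent_set (G : Type u) [Group G] [Countable G] [Infinite G] :
    ∃ A : Set G, A.Nonempty ∧
      (∀ n : ℕ, ∃ F : Finset G, ∀ a ∈ A, ∃ T ⊆ F, n ≤ T.card ∧ ∀ g ∈ T, g⁻¹ * a ∈ A) ∧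
      ∀ F : Finset G, ∃ g : G, ∀ f ∈ F, ∀ f' ∈ F, ∀ a ∈ A, ∀ b ∈ A, f * a ≠ g * (f' * b) := by
  classical
  let S := {s : Finset G × Finset G // ∀ p ∈ s.1, ∀ q ∈ s.1, p * q⁻¹ ∉ s.2}
  have step : ∀ (s : S) (F : Finset G), ∃ (s' : S) (x g : G),
      s'.1.1 = s.1.1 ∪ s.1.1.image (· * x) ∧ Disjoint s.1.1 (s.1.1.image (· * x)) ∧
      s.1.2 ⊆ s'.1.2 ∧ ∀ f ∈ F, ∀ f' ∈ F, f⁻¹ * g * f' ∈ s'.1.2 := by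
    rintro ⟨⟨P, B⟩, h⟩ F
    obtain ⟨x, g, B', h1, h2, h3, h4⟩ := exists_union_image_mul_right P B F h
    exact ⟨⟨⟨_, B'⟩, h4⟩, x, g, rfl, h3, h1, h2⟩
  choose next x g hP hdisj hB hg using step
  -- Every finite subset of `G` is treated at some stage; since the forbidden sets only grow, what
  -- is then achieved stays true.
  obtain ⟨e, he⟩ := exists_surjective_nat (Finset G)
  let s : ℕ → S := fun n => n.rec ⟨({1}, ∅), by simp⟩ fun n s => next s (e n)
  have hs : ∀ n, s (n + 1) = next (s n) (e n) := fun n => rfl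
  let P : ℕ → Finset G := fun n => (s n).1.1
  have hP0 : P 0 = {1} := rfl
  have hPs : ∀ n, P (n + 1) = P n ∪ (P n).image (· * x (s n) (e n)) := fun n => hP _ _
  have hPmono : Monotone P := monotone_nat_of_le_succ fun n => by
    rw [hPs]; exact Finset.subset_union_left
  have hBmono : Monotone fun n => (s n).1.2 := monotone_nat_of_le_succ fun n => hB _ _
  have hcard : ∀ n, n + 1 ≤ (P n).card := by
    intro n
    induction n with
    | zero => simp [hP0]
    | succ n ih =>
      rw [hPs, Finset.card_union_of_disjoint (hdisj _ _),
        Finset.card_image_of_injective _ (mul_left_injective _)]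
      change n + 1 + 1 ≤ (P n).card + (P n).card
      omega
  have hone : ∀ n, (1 : G) ∈ P n := fun n => hPmono (Nat.zero_le n) (by simp [hP0])
  -- Self-similarity: each later stage is a union of right translates `P n * t` of the stage `P n`.
  -- This is the source of recurrence.
  have hfac : ∀ n k, ∀ a ∈ P (n + k), ∃ q ∈ P n, ∃ t,
      a = q * t ∧ ∀ q' ∈ P n, q' * t ∈ P (n + k) := by
    intro n k
    induction k with
    | zero => exact fun a ha => ⟨a, ha, 1, by simp, by simp⟩
    | succ k ih =>
      intro a ha
      rw [← add_assoc, hPs, Finset.mem_union] at ha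
      rcases ha with ha | ha
      · obtain ⟨q, hq, t, h1, h2⟩ := ih a ha
        exact ⟨q, hq, t, h1, fun q' hq' => hPmono (Nat.le_succ _) (h2 q' hq')⟩
      · obtain ⟨b, hb, rfl⟩ := Finset.mem_image.1 ha
        obtain ⟨q, hq, t, rfl, h2⟩ := ih b hb
        refine ⟨q, hq, t * x (s (n + k)) (e (n + k)), by simp only [mul_assoc], fun q' hq' => ?_⟩
        rw [← add_assoc, hPs, Finset.mem_union]
        exact Or.inr (Finset.mem_image.2 ⟨_, h2 q' hq', by simp only [mul_assoc]⟩)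
  refine ⟨⋃ n, (P n : Set G), ⟨1, Set.mem_iUnion.2 ⟨0, hone 0⟩⟩, fun n => ?_, fun F => ?_⟩
  · refine ⟨(P n ×ˢ P n).image fun t => t.1 * t.2⁻¹, fun a ha => ?_⟩
    obtain ⟨m, hm⟩ := Set.mem_iUnion.1 ha
    obtain ⟨q, hq, t, rfl, h2⟩ := hfac n m a (hPmono (by omega) hm)
    refine ⟨(P n).image fun q' => q * q'⁻¹, ?_, ?_, ?_⟩
    · intro y hy
      obtain ⟨q', hq', rfl⟩ := Finset.mem_image.1 hy
      exact Finset.mem_image.2 ⟨(q, q'), by simp [hq, hq'], rfl⟩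
    · rw [Finset.card_image_of_injective _ fun a b h => by simpa using h]
      have := hcard n
      omega
    · intro y hy
      obtain ⟨q', hq', rfl⟩ := Finset.mem_image.1 hy
      refine Set.mem_iUnion.2 ⟨n + m, ?_⟩
      have : (q * q'⁻¹)⁻¹ * (q * t) = q' * t := by group
      rw [this]
      exact h2 q' hq'
  · obtain ⟨n, rfl⟩ := he F
    refine ⟨g (s n) (e n), fun f hf f' hf' a ha b hb hab => ?_⟩
    obtain ⟨i, hi⟩ := Set.mem_iUnion.1 ha
    obtain ⟨j, hj⟩ := Set.mem_iUnion.1 hb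
    set m := i + j + (n + 1)
    refine (s m).2 a (hPmono (by omega : i ≤ m) hi) b (hPmono (by omega : j ≤ m) hj) ?_
    have : a * b⁻¹ = f⁻¹ * g (s n) (e n) * f' := by
      rw [mul_inv_eq_iff_eq_mul, mul_assoc, mul_assoc, ← hab]
      group
    rw [this]
    exact hBmono (by omega : n + 1 ≤ m) (hg (s n) (e n) f hf f' hf')

end SparseSet

open Filter Topology

/-! ### Translation on ultrafilters: freeness and a minimal locally compact piece -/

section UltrafilterAction

variable {G : Type u} [Group G]

/-- The action of a group on its ultrafilters by left translation. -/
instance ultrafilterMulAction : MulAction G (Ultrafilter G) where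
  smul g z := z.map (g * ·)
  one_smul z := by
    change z.map (1 * ·) = z
    simp
  mul_smul g h z := by
    change z.map (g * h * ·) = (z.map (h * ·)).map (g * ·)
    rw [Ultrafilter.map_map]
    congr 1
    ext x
    simp [mul_assoc]

instance ultrafilterContinuousConstSMul : ContinuousConstSMul G (Ultrafilter G) where
  continuous_const_smul g := by
    refine ultrafilterBasis_is_basis.continuous_iff.2 ?_
    rintro _ ⟨s, rfl⟩
    exact ultrafilter_isOpen_basic _

/-- A translation without fixed points moves some set off itself which, together with its two
neighbouring translates, covers the group. -/
lemma exists_disjoint_translate_cover {g : G} (hg : g ≠ 1) :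
    ∃ s : Set G, (∀ x ∈ s, g * x ∉ s) ∧ ∀ x, x ∈ s ∨ g⁻¹ * x ∈ s ∨ g * x ∈ s := by
  obtain ⟨s, hs⟩ := zorn_subset {s : Set G | ∀ x ∈ s, g * x ∉ s} (by
    intro c hc hchain
    refine ⟨⋃₀ c, ?_, fun t ht => Set.subset_sUnion_of_mem ht⟩
    rintro x ⟨t, ht, hx⟩ ⟨t', ht', hx'⟩
    rcases hchain.total ht ht' with h | h
    · exact hc ht' x (h hx) hx'
    · exact hc ht x hx (h hx'))
  -- A point outside the maximal set `s` with neither neighbour in `s` could be added to it; `g ≠ 1`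
  -- ensures that the point does not collide with its own translate.
  refine ⟨s, hs.prop, fun x => ?_⟩
  by_contra! hx
  refine hx.1 (hs.le_of_ge (y := insert x s) ?_ (Set.subset_insert _ _) (Set.mem_insert _ _))
  rintro y (rfl | hy) (h | h)
  · exact hg (by simpa using h)
  · exact hx.2.2 h
  · exact hx.2.1 (by rw [← h]; simpa using hy)
  · exact hs.prop y hy h

/-- One of the three translates covering `G` belongs to `z`; if `z` is fixed, all three do, although
neighbouring ones are disjoint. -/
theorem eq_one_of_smul_ultrafilter_eq {g : G} {z : Ultrafilter G} (h : g • z = z) : g = 1 := by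
  by_contra hg
  obtain ⟨s, h1, h2⟩ := exists_disjoint_translate_cover hg
  have h' : g⁻¹ • z = z := by rw [inv_smul_eq_iff, h]
  have hu : s ∪ ((g⁻¹ * ·) ⁻¹' s ∪ (g * ·) ⁻¹' s) ∈ z :=
    Filter.mem_of_superset Filter.univ_mem fun x _ => h2 x
  have hs : s ∈ z := by
    rcases Ultrafilter.union_mem_iff.1 hu with hu | hu
    · exact hu
    · rcases Ultrafilter.union_mem_iff.1 hu with hu | hu
      · rw [← h']; exact hu
      · rw [← h]; exact hu
  have hgs : (g * ·) ⁻¹' s ∈ z := by rw [← h] at hs; exact hs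
  obtain ⟨x, hx, hgx⟩ := z.nonempty_of_mem (Filter.inter_mem hs hgs)
  exact h1 x hx hgx

/-- Among the closed invariant sets of ultrafilters that meet the set of ultrafilters containing
`A`, there is a minimal one. -/
lemma exists_minimal_closed_invariant {A : Set G} (hA : A.Nonempty) :
    ∃ Y : Set (Ultrafilter G), Minimal (· ∈ {Y : Set (Ultrafilter G) |
      IsClosed Y ∧ (∀ (g : G), ∀ z ∈ Y, g • z ∈ Y) ∧ (Y ∩ {z | A ∈ z}).Nonempty}) Y := by
  obtain ⟨a, ha⟩ := hA
  obtain ⟨Y, -, hY⟩ := zorn_superset_nonempty {Y : Set (Ultrafilter G) |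
      IsClosed Y ∧ (∀ (g : G), ∀ z ∈ Y, g • z ∈ Y) ∧ (Y ∩ {z | A ∈ z}).Nonempty} (by
    intro c hc hchain hne
    refine ⟨⋂₀ c, ⟨isClosed_sInter fun t ht => (hc ht).1,
      fun g z hz t ht => (hc ht).2.1 g z (hz t ht), ?_⟩, fun t ht => Set.sInter_subset_of_mem ht⟩
    have hne' : Nonempty c := hne.to_subtype
    -- The traces on the clopen set of ultrafilters containing `A` are compact, so the intersection
    -- of a chain still meets that set.
    have key := IsCompact.nonempty_iInter_of_directed_nonempty_isCompact_isClosed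
      (fun t : c => t.1 ∩ {z | A ∈ z}) ?_ (fun t => (hc t.2).2.2)
      (fun t => ((hc t.2).1.inter (ultrafilter_isClosed_basic A)).isCompact)
      (fun t => (hc t.2).1.inter (ultrafilter_isClosed_basic A))
    · rwa [← Set.iInter_inter, ← Set.sInter_eq_iInter] at key
    · intro t t'
      rcases hchain.total t.2 t'.2 with h | h
      · exact ⟨t, subset_rfl, Set.inter_subset_inter_left _ h⟩
      · exact ⟨t', Set.inter_subset_inter_left _ h, subset_rfl⟩)
    Set.univ ⟨isClosed_univ, fun _ _ _ => trivial, ⟨pure a, trivial, ha⟩⟩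
  exact ⟨Y, hY⟩

/-- A countably infinite group acts freely and minimally on a locally compact space which is
neither compact nor discrete and sits equivariantly in the space of ultrafilters on the group. -/
theorem exists_minimal_invariant_ultrafilters (G : Type u) [Group G] [Countable G] [Infinite G] :
    ∃ Z : Set (Ultrafilter G), (∀ (g : G), ∀ z ∈ Z, g • z ∈ Z) ∧ IsLocallyClosed Z ∧
      ¬ DiscreteTopology Z ∧ ¬ IsCompact Z ∧
      ∀ z ∈ Z, Z ⊆ closure (Set.range fun g : G => g • z) := by
  classical
  obtain ⟨A, hA, hrec, hthin⟩ := exists_thin_recurrent_set G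
  obtain ⟨Y, hY⟩ := exists_minimal_closed_invariant hA
  obtain ⟨hYc, hYi, y, hyY, hyA⟩ := hY.prop
  set U : Set (Ultrafilter G) := ⋃ g : G, {z | A ∈ g • z} with hU
  have hUo : ∀ g : G, IsOpen {z : Ultrafilter G | A ∈ g • z} :=
    fun g => ultrafilter_isOpen_basic ((g * ·) ⁻¹' A)
  have hAU : ∀ z : Ultrafilter G, A ∈ z → z ∈ U := fun z hz =>
    Set.mem_iUnion.2 ⟨1, by simpa using hz⟩
  have hZi : ∀ g : G, ∀ z ∈ Y ∩ U, g • z ∈ Y ∩ U := by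
    rintro g z ⟨hzY, hzU⟩
    obtain ⟨k, hk⟩ := Set.mem_iUnion.1 hzU
    exact ⟨hYi g z hzY, Set.mem_iUnion.2 ⟨k * g⁻¹, by simpa [smul_smul] using hk⟩⟩
  refine ⟨Y ∩ U, hZi, hYc.isLocallyClosed.inter (isOpen_iUnion hUo).isLocallyClosed, ?_, ?_, ?_⟩
  · intro hdisc
    have hfin : (Y ∩ {z | A ∈ z}).Finite := by
      refine (hYc.inter (ultrafilter_isClosed_basic A)).isCompact.finite ?_
      exact (isDiscrete_iff_discreteTopology.2 hdisc).mono
        (Set.inter_subset_inter_right _ hAU)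
    obtain ⟨F, hF⟩ := hrec (hfin.toFinset.card + 1)
    -- The set of directions `T` depends on `a`, but only finitely many `T` occur, so the
    -- ultrafilter `y` selects one. By freeness it gives more distinct points `g⁻¹ • y` than the
    -- finite set can hold.
    have hmem : (⋃ T ∈ {T : Finset G | T ⊆ F ∧ hfin.toFinset.card + 1 ≤ T.card},
        {a : G | ∀ g ∈ T, g⁻¹ * a ∈ A}) ∈ y := by
      refine Filter.mem_of_superset hyA fun a ha => ?_
      obtain ⟨T, hT, h1, h2⟩ := hF a ha
      exact Set.mem_biUnion (show T ∈ {T : Finset G | _} from ⟨hT, h1⟩) h2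
    rw [Ultrafilter.finite_biUnion_mem_iff
      ((Finset.finite_toSet F.powerset).subset fun T hT => by simpa using hT.1)] at hmem
    obtain ⟨T, ⟨-, hTcard⟩, hT⟩ := hmem
    have : T.card ≤ hfin.toFinset.card := by
      refine Finset.card_le_card_of_injOn (fun g => g⁻¹ • y) ?_ ?_
      · intro g hg
        simp only [Finset.mem_coe, Set.Finite.mem_toFinset]
        exact ⟨hYi _ _ hyY, Filter.mem_of_superset hT fun a ha => ha g hg⟩
      · intro g _ k _ h
        have := eq_one_of_smul_ultrafilter_eq (g := k * g⁻¹) (z := y)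
          (by rw [mul_smul]; dsimp only at h; rw [h, smul_inv_smul])
        rw [mul_inv_eq_one] at this
        exact this.symm
    omega
  · intro hcomp
    obtain ⟨F, hF⟩ := hcomp.elim_finite_subcover _ hUo Set.inter_subset_right
    -- Covering both `y` and `g⁻¹ • y` by the finitely many clopen sets makes the translates of `A`
    -- by `F⁻¹` and by `g F⁻¹` meet, against thinness.
    obtain ⟨g, hg⟩ := hthin (F.image (·⁻¹))
    have hy : y ∈ Y ∩ U := ⟨hyY, hAU y hyA⟩
    obtain ⟨k, hk, hk'⟩ := Set.mem_iUnion₂.1 (hF hy)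
    obtain ⟨l, hl, hl'⟩ := Set.mem_iUnion₂.1 (hF (hZi g⁻¹ y hy))
    obtain ⟨a, ha, ha'⟩ := y.nonempty_of_mem (Filter.inter_mem
      (show (k * ·) ⁻¹' A ∈ y from hk') (show (g⁻¹ * ·) ⁻¹' ((l * ·) ⁻¹' A) ∈ y from hl'))
    refine hg k⁻¹ (Finset.mem_image_of_mem _ hk) l⁻¹ (Finset.mem_image_of_mem _ hl) _ ha _ ha' ?_
    simp
  · rintro z ⟨hzY, hzU⟩ w ⟨hwY, -⟩
    refine hY.le_of_le (y := closure (Set.range fun g : G => g • z)) ⟨isClosed_closure, ?_, ?_⟩ ?_ hwY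
    · intro g w hw
      refine map_mem_closure (continuous_const_smul g) hw ?_
      rintro _ ⟨k, rfl⟩
      exact ⟨g * k, mul_smul _ _ _⟩
    · obtain ⟨k, hk⟩ := Set.mem_iUnion.1 hzU
      exact ⟨k • z, subset_closure ⟨k, rfl⟩, hk⟩
    · refine closure_minimal ?_ hYc
      rintro _ ⟨k, rfl⟩
      exact hYi k z hzY

end UltrafilterAction

/-! ### From approximate means on the group to amenable actions -/

section AmenableExtension

variable {G : Type u} [Group G]

/-- Approximately equivariant maps `G → Prob G` with values supported in a fixed finite set. -/
def HasFiniteApproxMeans (G : Type u) [Group G] : Prop :=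
  ∀ (F : Finset G) (ε : ℝ), 0 < ε → ∃ (S : Finset G) (m : G → G → ℝ),
    (∀ x g, 0 ≤ m x g) ∧ (∀ x, ∀ g ∉ S, m x g = 0) ∧ (∀ x, ∑ g ∈ S, m x g = 1) ∧
    ∀ s ∈ F, ∀ x, ∀ T : Finset G, ∑ g ∈ T, |m x (s⁻¹ * g) - m (s * x) g| ≤ ε

/-- Every bounded function on `G` extends continuously to the ultrafilters on `G`. -/
lemma exists_continuous_tendsto_ultrafilter {α : Type*} (f : α → ℝ) {a b : ℝ}
    (hf : ∀ x, f x ∈ Set.Icc a b) :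
    ∃ f' : Ultrafilter α → ℝ, Continuous f' ∧ ∀ z : Ultrafilter α, Tendsto f z (𝓝 (f' z)) := by
  let e : α → Set.Icc a b := fun x => ⟨f x, hf x⟩
  refine ⟨fun z => (Ultrafilter.extend e z).1,
    continuous_subtype_val.comp (continuous_ultrafilter_extend e), fun z => ?_⟩
  have : Tendsto e z (𝓝 (Ultrafilter.extend e z)) := ultrafilter_extend_eq_iff.1 rfl
  exact (continuous_subtype_val.tendsto _).comp this

/-- The coordinates of the means extend to ultrafilters as limits. The common finite support lets
total mass `1` and the `ℓ¹` estimate, both finite sums, pass to the limit. -/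
theorem isAmenableAction_of_equivariant (h : HasFiniteApproxMeans G) {X : Type v}
    [TopologicalSpace X] [MulAction G X] (j : X → Ultrafilter G) (hj : Continuous j)
    (hjs : ∀ (g : G) x, j (g • x) = g • j x) : IsAmenableAction G X := by
  classical
  intro F K _ ε hε
  -- Limits preserve only the weak inequality, hence the margin `ε / 2`.
  obtain ⟨S, m, h0, hS, h1, hm⟩ := h F (ε / 2) (half_pos hε)
  have hle : ∀ g x, m x g ∈ Set.Icc (0 : ℝ) 1 := by
    refine fun g x => ⟨h0 x g, ?_⟩
    by_cases hg : g ∈ S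
    · rw [← h1 x]
      exact Finset.single_le_sum (fun i _ => h0 x i) hg
    · rw [hS x g hg]
      exact zero_le_one
  choose M hMc hM using fun g => exists_continuous_tendsto_ultrafilter (fun x => m x g) (hle g)
  have hM0 : ∀ z, ∀ g ∉ S, M g z = 0 := fun z g hg =>
    tendsto_nhds_unique (hM g z) (by simp [hS _ g hg])
  refine ⟨fun x g => M g (j x), fun g => (hMc g).comp hj, fun x g => ?_, fun x => ?_, ?_⟩
  · exact ge_of_tendsto' (hM g (j x)) fun y => h0 y g
  · have : ∑ g ∈ S, M g (j x) = 1 :=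
      tendsto_nhds_unique (tendsto_finsetSum S fun g _ => hM g (j x)) (by simp [h1])
    rw [← this]
    exact hasSum_sum_of_ne_finset_zero fun g hg => hM0 _ g hg
  · intro s hs x _
    have hmap : ∀ g, Tendsto (fun y => m (s * y) g) (j x) (𝓝 (M g (j (s • x)))) := by
      intro g
      rw [hjs]
      exact tendsto_map'_iff.1 (hM g (s • j x))
    rw [tsum_eq_sum (s := S ∪ S.image (s * ·))]
    · refine lt_of_le_of_lt (le_of_tendsto' (f := fun y => ∑ g ∈ S ∪ S.image (s * ·),
        |m y (s⁻¹ * g) - m (s * y) g|) (x := (j x : Filter G)) ?_ fun y => hm s hs y _)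
        (half_lt_self hε)
      exact tendsto_finsetSum _ fun g _ => ((hM _ _).sub (hmap g)).abs
    · intro g hg
      simp only [Finset.mem_union, Finset.mem_image, not_or, not_exists, not_and] at hg
      beta_reduce
      rw [hM0 _ _ hg.1, hM0 _ (s⁻¹ * g) fun h => hg.2 _ h (by simp)]
      simp

end AmenableExtension

/-! ### Squares and negative parts in C⋆-algebras -/

section CStarOrder

variable {M : Type*} [NonUnitalCStarAlgebra M] [PartialOrder M] [StarOrderedRing M]

lemma exists_eq_star_mul_self_of_nonneg {a : M} (ha : 0 ≤ a) : ∃ y, a = star y * y :=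
  CStarAlgebra.nonneg_iff_eq_star_mul_self.1 ha

/-- A self-adjoint element `a` is non-negative if `y = 0`, where `-(y⋆ y)` is the compression of
`a` by its negative part. -/
lemma exists_compression_eq_neg_star_mul_self {a : M} (ha : IsSelfAdjoint a) :
    ∃ N y : M, star N = N ∧ N * a * N = -(star y * y) ∧ (y = 0 → 0 ≤ a) := by
  have hN0 : 0 ≤ a⁻ := CFC.negPart_nonneg a
  have hNs : star a⁻ = a⁻ := hN0.isSelfAdjoint
  have hcube : a⁻ * a * a⁻ = -(a⁻ * a⁻ * a⁻) := by
    have : a⁻ * a = -(a⁻ * a⁻) := by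
      conv_lhs =>
        enter [2]
        rw [← CFC.posPart_sub_negPart a ha]
      rw [mul_sub, CFC.negPart_mul_posPart, zero_sub]
    rw [this, neg_mul]
  obtain ⟨y, hy⟩ := exists_eq_star_mul_self_of_nonneg (conjugate_nonneg_of_nonneg hN0 hN0)
  refine ⟨a⁻, y, hNs, by rw [hcube, hy], fun hy0 => ?_⟩
  rw [hy0, mul_zero] at hy
  have h4 : a⁻ * a⁻ = 0 := by
    refine (CStarRing.star_mul_self_eq_zero_iff (a⁻ * a⁻)).1 ?_
    rw [star_mul, hNs, ← mul_assoc, hy, zero_mul]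
  have h5 : a⁻ = 0 := (CStarRing.star_mul_self_eq_zero_iff a⁻).1 (by rw [hNs, h4])
  rw [← CFC.posPart_sub_negPart a ha, h5, sub_zero]
  exact CFC.posPart_nonneg a

end CStarOrder

/-! ### Positive matrices over a C⋆-algebra and completely positive maps -/

section CStarMatrixPositivity

variable {A : Type*} [CStarAlgebra A]
  {K : Type*} [NormedAddCommGroup K] [InnerProductSpace ℂ K] [CompleteSpace K] {n : ℕ}

/-- The action of a matrix over `A` on a tuple of vectors of a representation of `A`. -/
noncomputable def matrixAct (ρ : A →⋆ₐ[ℂ] (K →L[ℂ] K)) (B : CStarMatrix (Fin n) (Fin n) A)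
    (ξ : Fin n → K) : Fin n → K :=
  fun i => ∑ j, ρ (B i j) (ξ j)

lemma matrixAct_mul (ρ : A →⋆ₐ[ℂ] (K →L[ℂ] K)) (B C : CStarMatrix (Fin n) (Fin n) A)
    (ξ : Fin n → K) : matrixAct ρ (B * C) ξ = matrixAct ρ B (matrixAct ρ C ξ) := by
  ext i
  simp only [matrixAct, CStarMatrix.mul_apply, map_sum, map_mul,
   mul_apply_eq_comp, sum_apply]
  exact Finset.sum_comm

lemma matrixAct_neg (ρ : A →⋆ₐ[ℂ] (K →L[ℂ] K)) (B : CStarMatrix (Fin n) (Fin n) A)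
    (ξ : Fin n → K) (i : Fin n) : matrixAct ρ (-B) ξ i = -matrixAct ρ B ξ i := by
  simp [matrixAct]

lemma matrixAct_add (ρ : A →⋆ₐ[ℂ] (K →L[ℂ] K)) (B C : CStarMatrix (Fin n) (Fin n) A)
    (ξ : Fin n → K) (i : Fin n) :
    matrixAct ρ (B + C) ξ i = matrixAct ρ B ξ i + matrixAct ρ C ξ i := by
  simp [matrixAct, Finset.sum_add_distrib]

lemma sum_inner_matrixAct_star (ρ : A →⋆ₐ[ℂ] (K →L[ℂ] K)) (B : CStarMatrix (Fin n) (Fin n) A)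
    (ξ η : Fin n → K) :
    ∑ i, inner ℂ (ξ i) (matrixAct ρ (star B) η i) = ∑ i, inner ℂ (matrixAct ρ B ξ i) (η i) := by
  simp only [matrixAct, inner_sum, sum_inner, CStarMatrix.star_apply, map_star,
    ContinuousLinearMap.star_eq_adjoint, ContinuousLinearMap.adjoint_inner_right]
  exact Finset.sum_comm

lemma eq_zero_of_matrixAct_eq_zero {ρ : A →⋆ₐ[ℂ] (K →L[ℂ] K)} (hρ : Function.Injective ρ)
    {B : CStarMatrix (Fin n) (Fin n) A} (h : ∀ ξ, matrixAct ρ B ξ = 0) : B = 0 := by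
  refine CStarMatrix.ext fun i j => hρ ?_
  ext v
  have := congrFun (h (Pi.single j v)) i
  rw [matrixAct, Finset.sum_eq_single j (by
    intro k _ hk
    rw [Pi.single_eq_of_ne hk, map_zero]) (by simp), Pi.single_eq_same] at this
  simpa using this

variable [PartialOrder A] [StarOrderedRing A]

/-- Positivity of a matrix over a C⋆-algebra can be tested in a faithful representation. -/
theorem cstarMatrix_nonneg_of_inner {ρ : A →⋆ₐ[ℂ] (K →L[ℂ] K)} (hρ : Function.Injective ρ)
    {B : CStarMatrix (Fin n) (Fin n) A} (hB : IsSelfAdjoint B)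
    (h : ∀ ξ : Fin n → K, 0 ≤ (∑ i, inner ℂ (ξ i) (matrixAct ρ B ξ i)).re) : 0 ≤ B := by
  obtain ⟨N, Y, hNs, hY, hpos⟩ := exists_compression_eq_neg_star_mul_self hB
  refine hpos (eq_zero_of_matrixAct_eq_zero hρ fun ξ => ?_)
  -- At the vector `N ξ` the form equals `-‖Y ξ‖²`, so `Y` acts as zero and vanishes by
  -- faithfulness.
  have h1 := h (matrixAct ρ N ξ)
  rw [← sum_inner_matrixAct_star, hNs, ← matrixAct_mul, ← matrixAct_mul, hY] at h1
  simp only [matrixAct_neg, inner_neg_right, Finset.sum_neg_distrib, matrixAct_mul] at h1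
  rw [sum_inner_matrixAct_star, Complex.neg_re, Complex.re_sum, Left.nonneg_neg_iff] at h1
  have h2 : ∀ i ∈ Finset.univ, 0 ≤ (inner ℂ (matrixAct ρ Y ξ i) (matrixAct ρ Y ξ i)).re :=
    fun i _ => inner_self_nonneg (𝕜 := ℂ)
  ext i
  have := (Finset.sum_eq_zero_iff_of_nonneg h2).1 (le_antisymm h1 (Finset.sum_nonneg h2)) i
    (Finset.mem_univ i)
  have h3 : ‖matrixAct ρ Y ξ i‖ ^ 2 = 0 := (norm_sq_eq_re_inner (𝕜 := ℂ) _).trans this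
  simpa using h3

lemma cstarMatrix_sum_apply {ι : Type*} (s : Finset ι) (f : ι → CStarMatrix (Fin n) (Fin n) ℂ)
    (i j : Fin n) : (∑ l ∈ s, f l) i j = ∑ l ∈ s, f l i j := by
  classical
  induction s using Finset.induction_on with
  | empty => simp
  | insert a s ha ih => simp [Finset.sum_insert ha, ih]

/-- The sum is the quadratic form of `X` at the vector `∑ i, eᵢ ⊗ eᵢ`; for `X = Y⋆ Y` it is a sum of
squares. -/
lemma sum_diagonal_apply_nonneg {X : CStarMatrix (Fin n) (Fin n) (CStarMatrix (Fin n) (Fin n) ℂ)}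
    (hX : 0 ≤ X) : 0 ≤ ∑ i, ∑ j, X i j i j := by
  obtain ⟨Y, rfl⟩ := exists_eq_star_mul_self_of_nonneg hX
  have : ∑ i, ∑ j, (star Y * Y) i j i j =
      ∑ l, ∑ m, star (∑ i, Y l i m i) * ∑ j, Y l j m j := by
    have e : ∀ i j, (star Y * Y) i j i j = ∑ l, ∑ m, star (Y l i m i) * Y l j m j := by
      intro i j
      rw [CStarMatrix.mul_apply]
      rw [cstarMatrix_sum_apply]
      simp only [CStarMatrix.mul_apply, CStarMatrix.star_apply]
    simp only [e, star_sum, Finset.sum_mul_sum]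
    calc ∑ i, ∑ j, ∑ l, ∑ m, star (Y l i m i) * Y l j m j
        = ∑ i, ∑ l, ∑ m, ∑ j, star (Y l i m i) * Y l j m j := by
          refine Finset.sum_congr rfl fun i _ => ?_
          rw [Finset.sum_comm]
          exact Finset.sum_congr rfl fun l _ => Finset.sum_comm
      _ = ∑ l, ∑ m, ∑ i, ∑ j, star (Y l i m i) * Y l j m j := by
          rw [Finset.sum_comm]
          exact Finset.sum_congr rfl fun l _ => Finset.sum_comm
  rw [this]
  exact Finset.sum_nonneg fun l _ => Finset.sum_nonneg fun m _ => star_mul_self_nonneg _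

/-- The linear functional on `Mₙ(A)` corresponding to a map `A → Mₙ(ℂ)`. -/
noncomputable def choiFunctional (φ : A →CP CStarMatrix (Fin n) (Fin n) ℂ)
    (B : CStarMatrix (Fin n) (Fin n) A) : ℂ :=
  ∑ i, ∑ j, φ (B i j) i j

lemma choiFunctional_nonneg (φ : A →CP CStarMatrix (Fin n) (Fin n) ℂ)
    {B : CStarMatrix (Fin n) (Fin n) A} (hB : 0 ≤ B) : 0 ≤ choiFunctional φ B :=
  sum_diagonal_apply_nonneg (φ.map_cstarMatrix_nonneg B hB)

lemma choiFunctional_star (φ : A →CP CStarMatrix (Fin n) (Fin n) ℂ)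
    (B : CStarMatrix (Fin n) (Fin n) A) :
    choiFunctional φ (star B) = star (choiFunctional φ B) := by
  simp only [choiFunctional, star_sum, CStarMatrix.star_apply, map_star]
  exact Finset.sum_comm

/-- The matrix `B` met in the separation argument need not be self-adjoint. Passing to `B + star B`
doubles both real parts, as the functional is hermitian. -/
lemma re_choiFunctional_nonneg (φ : A →CP CStarMatrix (Fin n) (Fin n) ℂ)
    {ρ : A →⋆ₐ[ℂ] (K →L[ℂ] K)} (hρ : Function.Injective ρ) {B : CStarMatrix (Fin n) (Fin n) A}
    (h : ∀ ξ : Fin n → K, 0 ≤ (∑ i, inner ℂ (ξ i) (matrixAct ρ B ξ i)).re) :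
    0 ≤ (choiFunctional φ B).re := by
  have key : 0 ≤ B + star B := by
    refine cstarMatrix_nonneg_of_inner hρ (IsSelfAdjoint.add_star_self B) fun ξ => ?_
    simp only [matrixAct_add, inner_add_right, Finset.sum_add_distrib, sum_inner_matrixAct_star]
    have : ∑ i, inner ℂ (matrixAct ρ B ξ i) (ξ i) =
        star (∑ i, inner ℂ (ξ i) (matrixAct ρ B ξ i)) := by
      rw [star_sum]
      exact Finset.sum_congr rfl fun i _ => (inner_conj_symm _ _).symm
    rw [this, Complex.add_re]
    exact add_nonneg (h ξ) (h ξ)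
  have h1 := (Complex.le_def.1 (choiFunctional_nonneg φ key)).1
  have h2 : choiFunctional φ (B + star B) = choiFunctional φ B + choiFunctional φ (star B) := by
    simp [choiFunctional, Finset.sum_add_distrib]
  rw [h2, choiFunctional_star, Complex.add_re] at h1
  have h3 : (star (choiFunctional φ B)).re = (choiFunctional φ B).re := rfl
  rw [h3, Complex.zero_re] at h1
  linarith

end CStarMatrixPositivity

/-! ### Approximating completely positive maps by finitely supported coefficients -/

section RegularRepresentation

variable {G : Type u} [Group G]

/-- The canonical unitaries of the reduced group C⋆-algebra. -/
noncomputable def LeftRegular.unitary (g : G) : reducedGroupCStarAlgebra G :=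
  ⟨(LeftRegular.rep g).toContinuousLinearMap,
    StarSubalgebra.le_topologicalClosure _ (StarAlgebra.subset_adjoin ℂ _ ⟨g, rfl⟩)⟩

lemma LeftRegular.unitary_mul (g h : G) :
    LeftRegular.unitary (g * h) = LeftRegular.unitary g * LeftRegular.unitary h := by
  refine Subtype.ext (ContinuousLinearMap.ext fun f => lp.ext (funext fun k => ?_))
  change f ((g * h)⁻¹ * k) = f (h⁻¹ * (g⁻¹ * k))
  simp [mul_assoc]

lemma LeftRegular.star_unitary_mul_self (g : G) :
    star (LeftRegular.unitary g) * LeftRegular.unitary g = 1 :=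
  Subtype.ext ((ContinuousLinearMap.norm_map_iff_adjoint_comp_self _).1
    (LeftRegular.rep g).norm_map)

/-- Systems of matrix coefficients, over a finite set `F`, of the representation of
`Mₙ(C⋆_λ(G))` on `ℓ²(G)ⁿ`, with respect to finitely many finitely supported vectors. -/
def finiteCoefficients (F : Finset G) (n : ℕ) : Set (F × Fin n × Fin n → ℂ) :=
  {v | ∃ (κ : Type) (_ : Fintype κ) (S : Finset G) (η : κ → Fin n → lp (fun _ : G => ℂ) 2),
    (∀ k i, ∀ g ∉ S, η k i g = 0) ∧
    v = fun p => ∑ k, inner ℂ (η k p.2.1) (LeftRegular.rep p.1.1 (η k p.2.2))}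

lemma smul_mem_finiteCoefficients {F : Finset G} {n : ℕ} {v : F × Fin n × Fin n → ℂ}
    (hv : v ∈ finiteCoefficients F n) {t : ℝ} (ht : 0 ≤ t) : t • v ∈ finiteCoefficients F n := by
  obtain ⟨κ, _, S, η, hS, rfl⟩ := hv
  refine ⟨κ, inferInstance, S, fun k i => ((√t : ℝ) : ℂ) • η k i, fun k i g hg => ?_, ?_⟩
  · rw [lp.coeFn_smul, Pi.smul_apply, hS k i g hg, smul_zero]
  · ext p
    have h : ((√t : ℝ) : ℂ) * ((√t : ℝ) : ℂ) = t := by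
      rw [← Complex.ofReal_mul, Real.mul_self_sqrt ht]
    simp only [Pi.smul_apply, map_smul, inner_smul_left, inner_smul_right, Complex.conj_ofReal,
      Finset.smul_sum, ← mul_assoc, h, Complex.real_smul]

lemma add_mem_finiteCoefficients {F : Finset G} {n : ℕ} {v w : F × Fin n × Fin n → ℂ}
    (hv : v ∈ finiteCoefficients F n) (hw : w ∈ finiteCoefficients F n) :
    v + w ∈ finiteCoefficients F n := by
  classical
  obtain ⟨κ, _, S, η, hS, rfl⟩ := hv
  obtain ⟨κ', _, S', η', hS', rfl⟩ := hw
  refine ⟨κ ⊕ κ', inferInstance, S ∪ S', Sum.elim η η', ?_, ?_⟩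
  · rintro (k | k) i g hg <;> rw [Finset.mem_union, not_or] at hg
    · exact hS k i g hg.1
    · exact hS' k i g hg.2
  · ext p
    simp [Fintype.sum_sum_type]

lemma zero_mem_finiteCoefficients (F : Finset G) (n : ℕ) : 0 ∈ finiteCoefficients F n := by
  refine ⟨Empty, inferInstance, ∅, fun k => k.elim, fun k => k.elim, ?_⟩
  ext p
  simp

lemma convex_finiteCoefficients (F : Finset G) (n : ℕ) : Convex ℝ (finiteCoefficients F n) :=
  fun _ hv _ hw _ _ ha hb _ => add_mem_finiteCoefficients (smul_mem_finiteCoefficients hv ha)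
    (smul_mem_finiteCoefficients hw hb)

/-- Positivity of a continuous sesquilinear expression on `ℓ²(G)ⁿ` can be tested on finitely
supported vectors. -/
lemma re_inner_matrixAct_nonneg_of_finite {A : Type*} [CStarAlgebra A] {n : ℕ}
    (ρ : A →⋆ₐ[ℂ] (lp (fun _ : G => ℂ) 2 →L[ℂ] lp (fun _ : G => ℂ) 2))
    (B : CStarMatrix (Fin n) (Fin n) A)
    (h : ∀ (S : Finset G) (ξ : Fin n → lp (fun _ : G => ℂ) 2), (∀ i, ∀ g ∉ S, ξ i g = 0) →
      0 ≤ (∑ i, inner ℂ (ξ i) (matrixAct ρ B ξ i)).re) (ξ : Fin n → lp (fun _ : G => ℂ) 2) :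
    0 ≤ (∑ i, inner ℂ (ξ i) (matrixAct ρ B ξ i)).re := by
  classical
  have hξ : Tendsto (fun (S : Finset G) i => ∑ g ∈ S, lp.single 2 g (ξ i g)) atTop (𝓝 ξ) :=
    tendsto_pi_nhds.2 fun i => lp.hasSum_single (by norm_num) (ξ i)
  have hc : Continuous fun ξ : Fin n → lp (fun _ : G => ℂ) 2 =>
      (∑ i, inner ℂ (ξ i) (matrixAct ρ B ξ i)).re := by
    unfold matrixAct
    fun_prop
  refine ge_of_tendsto' ((hc.tendsto ξ).comp hξ) fun S => h S _ fun i g hg => ?_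
  rw [lp.coeFn_sum, Finset.sum_apply]
  refine Finset.sum_eq_zero fun k hk => ?_
  rw [lp.single_apply, Pi.single_eq_of_ne]
  rintro rfl
  exact hg hk

variable [PartialOrder (reducedGroupCStarAlgebra G)] [StarOrderedRing (reducedGroupCStarAlgebra G)]

/-- A completely positive map from the reduced group C⋆-algebra to a matrix algebra is a limit of
maps given by finitely supported vectors. -/
theorem exists_finite_coefficients_approx {n : ℕ}
    (φ : reducedGroupCStarAlgebra G →CP CStarMatrix (Fin n) (Fin n) ℂ) (F : Finset G) {ε : ℝ}
    (hε : 0 < ε) :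
    ∃ (κ : Type) (_ : Fintype κ) (S : Finset G) (η : κ → Fin n → lp (fun _ : G => ℂ) 2),
      (∀ k i, ∀ g ∉ S, η k i g = 0) ∧ ∀ s ∈ F, ∀ i j,
        ‖∑ k, inner ℂ (η k i) (LeftRegular.rep s (η k j)) - φ (LeftRegular.unitary s) i j‖ < ε := by
  set v : F × Fin n × Fin n → ℂ := fun p => φ (LeftRegular.unitary p.1.1) p.2.1 p.2.2 with hv
  suffices hmem : v ∈ closure (finiteCoefficients F n) by
    obtain ⟨w, ⟨κ, _, S, η, hS, rfl⟩, hw⟩ := Metric.mem_closure_iff.1 hmem ε hε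
    refine ⟨κ, inferInstance, S, η, hS, fun s hs i j => ?_⟩
    have := (dist_pi_lt_iff hε).1 hw (⟨s, hs⟩, i, j)
    rwa [dist_comm, dist_eq_norm] at this
  by_contra hmem
  -- The coefficient systems form a convex cone, so a separating functional has non-negative real
  -- part on it and negative real part at `v`. Its coefficients define a matrix `B` over the reduced
  -- C⋆-algebra whose form has non-negative real part, while `choiFunctional φ B = f v`: a
  -- contradiction.
  obtain ⟨f, u, hfv, hf⟩ := RCLike.geometric_hahn_banach_point_closed (𝕜 := ℂ)
    (convex_finiteCoefficients F n).closure isClosed_closure hmem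
  replace hf : ∀ w ∈ finiteCoefficients F n, u < (f w).re := fun w hw => hf w (subset_closure hw)
  have hu : u < 0 := by simpa using hf 0 (zero_mem_finiteCoefficients F n)
  have hf0 : ∀ w ∈ finiteCoefficients F n, 0 ≤ (f w).re := by
    intro w hw
    by_contra! hneg
    -- This rescaling makes the real part exactly `u`, which the strict separation forbids.
    have h1 := hf _ (smul_mem_finiteCoefficients hw (t := u / (f w).re)
      (div_nonneg_of_nonpos hu.le hneg.le))
    rw [← Complex.coe_smul, map_smul, smul_eq_mul, Complex.re_ofReal_mul,
      div_mul_cancel₀ _ hneg.ne] at h1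
    exact lt_irrefl _ h1
  classical
  set c : F × Fin n × Fin n → ℂ := fun p => f (Pi.single p 1) with hc
  have hfc : ∀ w, f w = ∑ i, ∑ j, ∑ s : F, c (s, i, j) * w (s, i, j) := by
    intro w
    have h1 : f w = ∑ p, c p * w p := by
      conv_lhs => rw [← Finset.univ_sum_single w]
      rw [map_sum]
      refine Finset.sum_congr rfl fun p _ => ?_
      rw [hc, mul_comm, ← smul_eq_mul, ← map_smul, ← Pi.single_smul]
      simp
    rw [h1, Fintype.sum_prod_type, Finset.sum_comm, Fintype.sum_prod_type]
  set B : CStarMatrix (Fin n) (Fin n) (reducedGroupCStarAlgebra G) :=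
    CStarMatrix.ofMatrix fun i j => ∑ s : F, c (s, i, j) • LeftRegular.unitary s.1 with hB
  have hBij : ∀ i j, B i j = ∑ s : F, c (s, i, j) • LeftRegular.unitary s.1 := fun _ _ => rfl
  have hpos := re_choiFunctional_nonneg φ (ρ := (reducedGroupCStarAlgebra G).subtype)
    Subtype.val_injective (B := B) (re_inner_matrixAct_nonneg_of_finite _ _ fun S ξ hξ => by
      have h1 := hf0 _ ⟨Unit, inferInstance, S, fun _ => ξ, fun _ => hξ, rfl⟩
      rw [hfc] at h1
      convert h1 using 2
      refine Finset.sum_congr rfl fun i _ => ?_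
      rw [matrixAct, inner_sum]
      refine Finset.sum_congr rfl fun j _ => ?_
      rw [hBij]
      simp only [map_sum, map_smul, sum_apply, smul_apply, inner_sum, inner_smul_right,
        Finset.univ_unique, Finset.sum_singleton]
      rfl)
  have h2 : choiFunctional φ B = f v := by
    rw [hfc]
    refine Finset.sum_congr rfl fun i _ => Finset.sum_congr rfl fun j _ => ?_
    rw [hBij]
    simp only [map_sum, map_smul, cstarMatrix_sum_apply, CStarMatrix.smul_apply, smul_eq_mul, hv]
  rw [h2] at hpos
  exact absurd (hfv.trans hu) (not_lt.2 hpos)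

end RegularRepresentation

/-! ### From almost equivariant vectors to probability measures -/

section ApproxMeans

/-- The weighted arithmetic–geometric mean inequality applied to `‖u - w‖ * (‖u‖ + ‖w‖)`; summed
termwise, it stands in for Cauchy–Schwarz. -/
lemma abs_norm_sq_sub_norm_sq_le {V : Type*} [NormedAddCommGroup V] (u w : V) {δ : ℝ} (hδ : 0 < δ) :
    |‖u‖ ^ 2 - ‖w‖ ^ 2| ≤ ‖u - w‖ ^ 2 / (2 * δ) + δ * (‖u‖ ^ 2 + ‖w‖ ^ 2) := by
  have h1 : |‖u‖ ^ 2 - ‖w‖ ^ 2| ≤ ‖u - w‖ * (‖u‖ + ‖w‖) := by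
    rw [sq_sub_sq, abs_mul, abs_of_nonneg (by positivity : 0 ≤ ‖u‖ + ‖w‖), mul_comm]
    gcongr
    exact abs_norm_sub_norm_le u w
  refine h1.trans ?_
  rw [div_add' _ _ _ (by positivity), le_div_iff₀ (by positivity)]
  nlinarith [sq_nonneg (‖u - w‖ - δ * (‖u‖ + ‖w‖)), mul_nonneg (sq_nonneg δ) (sq_nonneg (‖u‖ - ‖w‖))]

variable {G : Type u} [Group G]

/-- Normalizing the squared norms of approximately equivariant families of vectors gives
approximately equivariant families of probability measures. -/
theorem hasFiniteApproxMeans_of_vectors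
    (h : ∀ (F : Finset G) (δ : ℝ), 0 < δ → ∃ (V : Type u) (_ : NormedAddCommGroup V)
      (S : Finset G) (a : G → G → V), (∀ x, ∀ g ∉ S, a x g = 0) ∧
      (∀ x, |∑ g ∈ S, ‖a x g‖ ^ 2 - 1| ≤ 1 / 2) ∧
      ∀ s ∈ F, ∀ x, ∀ T : Finset G, ∑ g ∈ T, ‖a x (s⁻¹ * g) - a (s * x) g‖ ^ 2 ≤ δ ^ 2) :
    HasFiniteApproxMeans G := by
  classical
  intro F ε hε
  -- The squared norms differ by `D ≤ 7/2 * δ` in total, and normalizing by masses at least `1/2`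
  -- costs at most `2 * D / (1/2) ≤ 14 * δ`.
  set δ := ε / 14 with hδ
  have hδ0 : 0 < δ := by positivity
  obtain ⟨V, _, S, a, hS, hM, ha⟩ := h F δ hδ0
  set M : G → ℝ := fun x => ∑ g ∈ S, ‖a x g‖ ^ 2 with hMdef
  have hM1 : ∀ x, 1 / 2 ≤ M x := fun x => by linarith [(abs_le.1 (hM x)).1]
  have hM2 : ∀ x, M x ≤ 3 / 2 := fun x => by linarith [(abs_le.1 (hM x)).2]
  have hM0 : ∀ x, 0 < M x := fun x => by linarith [hM1 x]
  refine ⟨S, fun x g => ‖a x g‖ ^ 2 / M x, fun x g => div_nonneg (sq_nonneg _) (hM0 x).le,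
    fun x g hg => by simp [hS x g hg], fun x => ?_, fun s hs x T => ?_⟩
  · rw [← Finset.sum_div]
    exact div_self (hM0 x).ne'
  -- Enlarging `T` to contain both supports makes the sums of squared norms over `T'` equal to the
  -- full masses.
  · set T' := T ∪ (S ∪ S.image (s * ·)) with hT'
    refine (Finset.sum_le_sum_of_subset_of_nonneg (Finset.subset_union_left (s₂ := S ∪ S.image
      (s * ·))) fun g _ _ => abs_nonneg _).trans ?_
    rw [← hT']
    have hc : ∑ g ∈ T', ‖a (s * x) g‖ ^ 2 = M (s * x) := by
      refine (Finset.sum_subset (Finset.subset_union_left.trans Finset.subset_union_right)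
        fun g _ hg => ?_).symm
      simp [hS _ g hg]
    have hb : ∑ g ∈ T', ‖a x (s⁻¹ * g)‖ ^ 2 = M x := by
      have : M x = ∑ g ∈ S.image (s * ·), ‖a x (s⁻¹ * g)‖ ^ 2 := by
        rw [Finset.sum_image (fun _ _ _ _ h => mul_left_cancel h)]
        simp [hMdef]
      rw [this]
      refine (Finset.sum_subset (Finset.subset_union_right.trans Finset.subset_union_right)
        fun g _ hg => ?_).symm
      rw [hS x (s⁻¹ * g) fun h => hg (Finset.mem_image.2 ⟨_, h, by simp⟩)]
      simp
    set D := ∑ g ∈ T', |‖a x (s⁻¹ * g)‖ ^ 2 - ‖a (s * x) g‖ ^ 2| with hD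
    have hD1 : D ≤ 7 / 2 * δ := by
      calc D ≤ ∑ g ∈ T', (‖a x (s⁻¹ * g) - a (s * x) g‖ ^ 2 / (2 * δ) +
            δ * (‖a x (s⁻¹ * g)‖ ^ 2 + ‖a (s * x) g‖ ^ 2)) :=
            Finset.sum_le_sum fun g _ => abs_norm_sq_sub_norm_sq_le _ _ hδ0
        _ = (∑ g ∈ T', ‖a x (s⁻¹ * g) - a (s * x) g‖ ^ 2) / (2 * δ) + δ * (M x + M (s * x)) := by
            rw [Finset.sum_add_distrib, ← Finset.sum_div, ← Finset.mul_sum, Finset.sum_add_distrib,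
              hb, hc]
        _ ≤ δ ^ 2 / (2 * δ) + δ * (3 / 2 + 3 / 2) := by
            gcongr
            exacts [ha s hs x T', hM2 _, hM2 _]
        _ = 7 / 2 * δ := by field_simp; ring
    have hD2 : |M (s * x) - M x| ≤ D := by
      rw [← hb, ← hc, abs_sub_comm, ← Finset.sum_sub_distrib]
      exact Finset.abs_sum_le_sum_abs _ _
    calc ∑ g ∈ T', |‖a x (s⁻¹ * g)‖ ^ 2 / M x - ‖a (s * x) g‖ ^ 2 / M (s * x)|
        ≤ ∑ g ∈ T', (|‖a x (s⁻¹ * g)‖ ^ 2 - ‖a (s * x) g‖ ^ 2| / M x +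
            ‖a (s * x) g‖ ^ 2 * (|M (s * x) - M x| / (M x * M (s * x)))) := by
          refine Finset.sum_le_sum fun g _ => ?_
          have e : ‖a x (s⁻¹ * g)‖ ^ 2 / M x - ‖a (s * x) g‖ ^ 2 / M (s * x) =
              (‖a x (s⁻¹ * g)‖ ^ 2 - ‖a (s * x) g‖ ^ 2) / M x +
              ‖a (s * x) g‖ ^ 2 * ((M (s * x) - M x) / (M x * M (s * x))) := by
            have := (hM0 x).ne'
            have := (hM0 (s * x)).ne'
            field_simp
            ring
          rw [e]
          refine (abs_add_le _ _).trans (le_of_eq ?_)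
          rw [abs_div, abs_mul, abs_div, abs_of_pos (hM0 x),
            abs_of_pos (mul_pos (hM0 x) (hM0 (s * x))), abs_of_nonneg (sq_nonneg ‖a (s * x) g‖)]
      _ = (D + |M (s * x) - M x|) / M x := by
          rw [Finset.sum_add_distrib, ← Finset.sum_div, ← Finset.sum_mul, hc, ← hD]
          have := (hM0 x).ne'
          have := (hM0 (s * x)).ne'
          field_simp
      _ ≤ ε := by
          rw [div_le_iff₀ (hM0 x)]
          nlinarith [hM1 x]

end ApproxMeans

/-! ### Matrix units and the Choi matrix -/

section Choi

variable {n : ℕ}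

/-- The matrix units of `Mₙ(ℂ)`. -/
noncomputable def matrixUnit (i j : Fin n) : CStarMatrix (Fin n) (Fin n) ℂ :=
  CStarMatrix.ofMatrix (Matrix.single i j 1)

lemma eq_sum_smul_matrixUnit (M : CStarMatrix (Fin n) (Fin n) ℂ) :
    M = ∑ i, ∑ j, M i j • matrixUnit i j := by
  refine CStarMatrix.ext fun k l => ?_
  simp only [cstarMatrix_sum_apply, CStarMatrix.smul_apply, matrixUnit,
    CStarMatrix.ofMatrix_apply, Matrix.single_apply, smul_eq_mul]
  rw [Finset.sum_eq_single k (by intro i _ hi; simp [hi]) (by simp),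
    Finset.sum_eq_single l (by intro i _ hi; simp [hi]) (by simp)]
  simp

lemma star_matrixUnit_mul_matrixUnit (i j k : Fin n) :
    star (matrixUnit k i) * matrixUnit k j = matrixUnit i j := by
  have : (Matrix.single k i (1 : ℂ)).conjTranspose * Matrix.single k j (1 : ℂ) =
      Matrix.single i j 1 := by
    rw [Matrix.conjTranspose_single, Matrix.single_mul_single_same]
    simp
  exact this

/-- It is `R⋆ R`, where `R` has a single non-zero row, numbered `i₀`, with entries `matrixUnit i₀
j`. -/
lemma matrixUnit_matrix_nonneg :
    (0 : CStarMatrix (Fin n) (Fin n) (CStarMatrix (Fin n) (Fin n) ℂ)) ≤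
      CStarMatrix.ofMatrix fun i j => matrixUnit i j := by
  rcases isEmpty_or_nonempty (Fin n) with h | ⟨⟨i₀⟩⟩
  · exact le_of_eq (CStarMatrix.ext fun i => h.elim i)
  · have : (CStarMatrix.ofMatrix fun i j => matrixUnit i j :
        CStarMatrix (Fin n) (Fin n) (CStarMatrix (Fin n) (Fin n) ℂ)) =
        star (CStarMatrix.ofMatrix fun l j => if l = i₀ then matrixUnit i₀ j else 0) *
          CStarMatrix.ofMatrix fun l j => if l = i₀ then matrixUnit i₀ j else 0 := by
      refine CStarMatrix.ext fun i j => ?_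
      rw [CStarMatrix.mul_apply, Finset.sum_eq_single i₀]
      · change matrixUnit i j = star (if i₀ = i₀ then matrixUnit i₀ i else 0) *
          if i₀ = i₀ then matrixUnit i₀ j else 0
        rw [if_pos rfl, if_pos rfl, star_matrixUnit_mul_matrixUnit]
      · intro l _ hl
        change _ * (if l = i₀ then matrixUnit i₀ j else 0) = 0
        rw [if_neg hl, mul_zero]
      · simp
    rw [this]
    exact star_mul_self_nonneg _

variable {H : Type*} [NormedAddCommGroup H] [InnerProductSpace ℂ H] [CompleteSpace H]

/-- The Choi matrix of a completely positive map is a square. -/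
lemma exists_choi_factorization (ψ : CStarMatrix (Fin n) (Fin n) ℂ →CP (H →L[ℂ] H)) :
    ∃ C : Fin n → Fin n → H →L[ℂ] H, ∀ i j v w,
      inner ℂ v (ψ (matrixUnit i j) w) = ∑ l, inner ℂ (C l i v) (C l j w) := by
  obtain ⟨C, hC⟩ := exists_eq_star_mul_self_of_nonneg
    (ψ.map_cstarMatrix_nonneg _ matrixUnit_matrix_nonneg)
  refine ⟨fun l j => C l j, fun i j v w => ?_⟩
  have : ψ (matrixUnit i j) = ∑ l, star (C l i) * C l j := by
    have := congrFun (congrFun hC i) j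
    rw [CStarMatrix.mul_apply] at this
    exact this
  rw [this, sum_apply, inner_sum]
  refine Finset.sum_congr rfl fun l _ => ?_
  rw [mul_apply_eq_comp, ContinuousLinearMap.star_eq_adjoint,
    ContinuousLinearMap.adjoint_inner_right]

end Choi

/-! ### Vectors built from coefficients and Choi operators -/

section CoefficientVectors

variable {G : Type u} {n : ℕ} {κ : Type}
  {H : Type u} [NormedAddCommGroup H] [InnerProductSpace ℂ H]

/-- The value at `g` of the vector in `ℓ²(G, H^(κ × n))` obtained from `v` by a system `η` of
vectors in `ℓ²(G)` and a matrix `C` of operators. -/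
noncomputable def coefficientVector (η : κ → Fin n → lp (fun _ : G => ℂ) 2)
    (C : Fin n → Fin n → H →L[ℂ] H) (v : H) (g : G) : PiLp 2 (fun _ : κ × Fin n => H) :=
  WithLp.toLp 2 fun p => ∑ j, η p.1 j g • C p.2 j v

lemma coefficientVector_eq_zero {η : κ → Fin n → lp (fun _ : G => ℂ) 2} {S : Finset G}
    (hη : ∀ k i, ∀ g ∉ S, η k i g = 0) (C : Fin n → Fin n → H →L[ℂ] H) (v : H) {g : G}
    (hg : g ∉ S) : coefficientVector η C v g = 0 := by
  ext p
  simp [coefficientVector, hη _ _ g hg]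

variable [Group G]

lemma inner_rep_eq_sum {f f' : lp (fun _ : G => ℂ) 2} {T : Finset G} (hf : ∀ g ∉ T, f g = 0)
    (s : G) : inner ℂ f (LeftRegular.rep s f') = ∑ g ∈ T, star (f g) * f' (s⁻¹ * g) := by
  rw [lp.inner_eq_tsum, tsum_eq_sum (s := T) fun g hg => by rw [hf g hg, inner_zero_left]]
  refine Finset.sum_congr rfl fun g _ => ?_
  rw [RCLike.inner_apply, mul_comm]
  rfl

variable [Fintype κ]

/-- The correlation separates into a factor replacing `φ` and a factor coming from the Choi
factorization of `ψ`; recombined, they give a matrix coefficient of an approximation to `ψ ∘ φ`. -/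
lemma sum_inner_coefficientVector {η : κ → Fin n → lp (fun _ : G => ℂ) 2} {T : Finset G}
    (hη : ∀ k i, ∀ g ∉ T, η k i g = 0) (C : Fin n → Fin n → H →L[ℂ] H) (v w : H) (s : G) :
    ∑ g ∈ T, inner ℂ (coefficientVector η C v g) (coefficientVector η C w (s⁻¹ * g)) =
      ∑ i, ∑ j, (∑ k, inner ℂ (η k i) (LeftRegular.rep s (η k j))) *
        ∑ l, inner ℂ (C l i v) (C l j w) := by
  have h1 : ∀ g, inner ℂ (coefficientVector η C v g) (coefficientVector η C w (s⁻¹ * g)) =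
      ∑ i, ∑ j, (∑ k, star (η k i g) * η k j (s⁻¹ * g)) * ∑ l, inner ℂ (C l i v) (C l j w) := by
    intro g
    rw [PiLp.inner_apply]
    have h2 : ∀ p : κ × Fin n,
        inner ℂ (∑ j, η p.1 j g • C p.2 j v) (∑ j, η p.1 j (s⁻¹ * g) • C p.2 j w) =
          ∑ i, ∑ j, star (η p.1 i g) * η p.1 j (s⁻¹ * g) * inner ℂ (C p.2 i v) (C p.2 j w) := by
      intro p
      rw [sum_inner]
      refine Finset.sum_congr rfl fun i _ => ?_
      rw [inner_sum]
      refine Finset.sum_congr rfl fun j _ => ?_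
      rw [inner_smul_left, inner_smul_right, ← mul_assoc]
      rfl
    refine (Finset.sum_congr rfl fun p _ => h2 p).trans ?_
    rw [Finset.sum_comm]
    refine Finset.sum_congr rfl fun i _ => ?_
    rw [Finset.sum_comm]
    refine Finset.sum_congr rfl fun j _ => ?_
    rw [Fintype.sum_prod_type, Finset.sum_mul_sum]
  simp only [h1, inner_rep_eq_sum (hη _ _)]
  rw [Finset.sum_comm]
  refine Finset.sum_congr rfl fun i _ => ?_
  rw [Finset.sum_comm]
  refine Finset.sum_congr rfl fun j _ => ?_
  rw [← Finset.sum_mul, Finset.sum_comm]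

end CoefficientVectors

/-! ### Exact groups have approximate means -/

section ExactGroup

variable {G : Type u} [Group G]

/-- A family `a` of finitely supported functions on `G` with values in a Hilbert space has small
displacement if its correlations are close to `1`. -/
lemma sum_norm_sub_sq_le {V : Type*} [NormedAddCommGroup V] [InnerProductSpace ℂ V]
    {S : Finset G} {a : G → G → V} (hS : ∀ x, ∀ g ∉ S, a x g = 0) {s x : G} {δ : ℝ}
    (h1 : ∀ x, |∑ g ∈ S, ‖a x g‖ ^ 2 - 1| ≤ δ)
    (hs : |(∑ g ∈ S, inner ℂ (a (s * x) g) (a x (s⁻¹ * g))).re - 1| ≤ δ) (T : Finset G) :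
    ∑ g ∈ T, ‖a x (s⁻¹ * g) - a (s * x) g‖ ^ 2 ≤ 4 * δ := by
  classical
  set T' := T ∪ (S ∪ S.image (s * ·)) with hT'
  have hST' : S ⊆ T' := Finset.subset_union_left.trans Finset.subset_union_right
  refine (Finset.sum_le_sum_of_subset_of_nonneg (Finset.subset_union_left (s₂ := S ∪ S.image
    (s * ·))) fun g _ _ => sq_nonneg _).trans ?_
  rw [← hT']
  have hc : ∑ g ∈ T', ‖a (s * x) g‖ ^ 2 = ∑ g ∈ S, ‖a (s * x) g‖ ^ 2 := by
    refine (Finset.sum_subset hST' fun g _ hg => ?_).symm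
    simp [hS _ g hg]
  have hb : ∑ g ∈ T', ‖a x (s⁻¹ * g)‖ ^ 2 = ∑ g ∈ S, ‖a x g‖ ^ 2 := by
    have : ∑ g ∈ S, ‖a x g‖ ^ 2 = ∑ g ∈ S.image (s * ·), ‖a x (s⁻¹ * g)‖ ^ 2 := by
      rw [Finset.sum_image (fun _ _ _ _ h => mul_left_cancel h)]
      simp
    rw [this]
    refine (Finset.sum_subset (Finset.subset_union_right.trans Finset.subset_union_right)
      fun g _ hg => ?_).symm
    rw [hS x (s⁻¹ * g) fun h => hg (Finset.mem_image.2 ⟨_, h, by simp⟩)]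
    simp
  have hi : ∑ g ∈ T', (inner ℂ (a (s * x) g) (a x (s⁻¹ * g))).re =
      (∑ g ∈ S, inner ℂ (a (s * x) g) (a x (s⁻¹ * g))).re := by
    rw [Complex.re_sum]
    refine (Finset.sum_subset hST' fun g _ hg => ?_).symm
    simp [hS _ g hg]
  have e : ∀ g, ‖a x (s⁻¹ * g) - a (s * x) g‖ ^ 2 = ‖a x (s⁻¹ * g)‖ ^ 2 + ‖a (s * x) g‖ ^ 2 -
      2 * (inner ℂ (a (s * x) g) (a x (s⁻¹ * g))).re := by
    intro g
    rw [norm_sub_rev, @norm_sub_sq ℂ]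
    simp only [RCLike.re_to_complex]
    ring
  simp only [e, Finset.sum_sub_distrib, Finset.sum_add_distrib, ← Finset.mul_sum]
  rw [hb, hc, hi]
  -- `(1 + δ) + (1 + δ) - 2 * (1 - δ) = 4 * δ`.
  linarith [(abs_le.1 (h1 x)).2, (abs_le.1 (h1 (s * x))).2, (abs_le.1 hs).1]

/-- A non-zero representation of a C⋆-algebra carrying an isometric representation of `G`
contains an orbit of unit vectors. -/
lemma exists_orbit_of_unit_vectors {A : Type*} [CStarAlgebra A] {u : G → A}
    (hu : ∀ s x, u (s * x) = u s * u x) (hu' : ∀ x, star (u x) * u x = 1)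
    {H : Type*} [NormedAddCommGroup H] [InnerProductSpace ℂ H] [CompleteSpace H] {π : A →⋆ₙₐ[ℂ] (H →L[ℂ] H)} (hπ : π 1 ≠ 0) :
    ∃ z : G → H, (∀ s x, π (u s) (z x) = z (s * x)) ∧ ∀ x, ‖z x‖ = 1 := by
  have hmul : ∀ a b v, π a (π b v) = π (a * b) v := by
    intro a b v
    rw [map_mul]
    rfl
  obtain ⟨v, hv⟩ : ∃ v, π 1 v ≠ 0 := by
    by_contra! h
    exact hπ (ContinuousLinearMap.ext h)
  -- `π` need not be unital, so the unit vector is taken in the range of the projection `π 1`.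
  obtain ⟨ζ, hζ1, hζ⟩ : ∃ ζ : H, ‖ζ‖ = 1 ∧ π 1 ζ = ζ := by
    refine ⟨((‖π 1 v‖⁻¹ : ℝ) : ℂ) • π 1 v, ?_, ?_⟩
    · rw [norm_smul, Complex.norm_real, norm_inv, norm_norm, inv_mul_cancel₀ (norm_ne_zero_iff.2 hv)]
    · rw [map_smul, hmul, one_mul]
  refine ⟨fun x => π (u x) ζ, fun s x => ?_, fun x => ?_⟩
  · rw [hmul, ← hu]
  · have h1 : inner ℂ (π (u x) ζ) (π (u x) ζ) =
        inner ℂ ζ ζ := by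
      rw [← ContinuousLinearMap.adjoint_inner_right, ← ContinuousLinearMap.star_eq_adjoint,
        ← map_star, hmul, hu', hζ]
    have h2 : ‖π (u x) ζ‖ ^ 2 = ‖ζ‖ ^ 2 := by
      rw [norm_sq_eq_re_inner (𝕜 := ℂ), h1, ← norm_sq_eq_re_inner]
    rw [(sq_eq_sq₀ (norm_nonneg _) (norm_nonneg _)).1 h2, hζ1]

lemma norm_sum_smul_sub_le {H : Type*} [NormedAddCommGroup H] [InnerProductSpace ℂ H]
    [CompleteSpace H] {n : ℕ} (ψ : CStarMatrix (Fin n) (Fin n) ℂ →CP (H →L[ℂ] H))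
    {t : Fin n → Fin n → ℂ} {M : CStarMatrix (Fin n) (Fin n) ℂ} {ε : ℝ}
    (h : ∀ i j, ‖t i j - M i j‖ ≤ ε) :
    ‖∑ i, ∑ j, t i j • ψ (matrixUnit i j) - ψ M‖ ≤
      ε * ∑ i : Fin n, ∑ j : Fin n, ‖ψ (matrixUnit i j)‖ := by
  have e : ψ M = ∑ i, ∑ j, M i j • ψ (matrixUnit i j) := by
    conv_lhs => rw [eq_sum_smul_matrixUnit M]
    simp only [map_sum, map_smul]
  rw [e]
  simp only [← Finset.sum_sub_distrib, ← sub_smul, Finset.mul_sum]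
  refine (norm_sum_le _ _).trans (Finset.sum_le_sum fun i _ =>
    (norm_sum_le _ _).trans (Finset.sum_le_sum fun j _ => ?_))
  rw [norm_smul]
  gcongr
  exact h i j

variable [PartialOrder (reducedGroupCStarAlgebra G)] [StarOrderedRing (reducedGroupCStarAlgebra G)]
  {H : Type u} [NormedAddCommGroup H] [InnerProductSpace ℂ H] [CompleteSpace H]

/-- A nuclear representation is approximated on the canonical unitaries by operators whose
coefficients factor through finitely supported vectors. -/
lemma exists_coefficient_operators {π : reducedGroupCStarAlgebra G →⋆ₙₐ[ℂ] (H →L[ℂ] H)}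
    (hnuc : IsNuclearMap π) (F : Finset G) {δ : ℝ} (hδ : 0 < δ) :
    ∃ (n : ℕ) (κ : Type) (_ : Fintype κ) (S : Finset G)
      (η : κ → Fin n → lp (fun _ : G => ℂ) 2) (C : Fin n → Fin n → H →L[ℂ] H) (Q : G → H →L[ℂ] H),
      (∀ k i, ∀ g ∉ S, η k i g = 0) ∧ (∀ s ∈ F, ‖Q s - π (LeftRegular.unitary s)‖ ≤ δ) ∧
      ∀ s v w, ∑ g ∈ S, inner ℂ (coefficientVector η C v g) (coefficientVector η C w (s⁻¹ * g)) =
        inner ℂ v (Q s w) := by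
  classical
  obtain ⟨n, φ, ψ, -, -, hφψ⟩ := hnuc (F.image LeftRegular.unitary) (δ / 2) (half_pos hδ)
  set R : ℝ := ∑ i : Fin n, ∑ j : Fin n, ‖ψ (matrixUnit i j)‖ with hR
  have hR0 : 0 ≤ R := Finset.sum_nonneg fun _ _ => Finset.sum_nonneg fun _ _ => norm_nonneg _
  have hε : 0 < δ / 2 / (R + 1) := by positivity
  obtain ⟨κ, _, S, η, hS, hη⟩ := exists_finite_coefficients_approx φ F hε
  obtain ⟨C, hC⟩ := exists_choi_factorization ψ
  refine ⟨n, κ, inferInstance, S, η, C, fun s => ∑ i, ∑ j,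
    (∑ k, inner ℂ (η k i) (LeftRegular.rep s (η k j))) • ψ (matrixUnit i j), hS,
    fun s hs => ?_, fun s v w => ?_⟩
  · have h1 := norm_sum_smul_sub_le ψ fun i j => (hη s hs i j).le
    have h2 := hφψ _ (Finset.mem_image_of_mem _ hs)
    refine (norm_sub_le_norm_sub_add_norm_sub _ (ψ (φ (LeftRegular.unitary s))) _).trans ?_
    have h3 : δ / 2 / (R + 1) * R ≤ δ / 2 := by
      rw [div_mul_eq_mul_div, div_le_iff₀ (by positivity)]
      nlinarith
    linarith
  · rw [sum_inner_coefficientVector hS]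
    simp only [sum_apply, smul_apply, inner_sum, inner_smul_right, hC]

/-- A non-zero nuclear representation of the reduced group C⋆-algebra yields approximately
equivariant families of vectors. -/
theorem exists_vectors_of_isNuclearMap {π : reducedGroupCStarAlgebra G →⋆ₙₐ[ℂ] (H →L[ℂ] H)}
    (hπ : π 1 ≠ 0) (hnuc : IsNuclearMap π) (F : Finset G) {δ : ℝ} (hδ : 0 < δ) :
    ∃ (V : Type u) (_ : NormedAddCommGroup V)
      (S : Finset G) (a : G → G → V), (∀ x, ∀ g ∉ S, a x g = 0) ∧
      (∀ x, |∑ g ∈ S, ‖a x g‖ ^ 2 - 1| ≤ δ) ∧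
      ∀ s ∈ F, ∀ x, ∀ T : Finset G, ∑ g ∈ T, ‖a x (s⁻¹ * g) - a (s * x) g‖ ^ 2 ≤ 4 * δ := by
  classical
  obtain ⟨z, hzmul, hz1⟩ := exists_orbit_of_unit_vectors LeftRegular.unitary_mul
    LeftRegular.star_unitary_mul_self hπ
  -- Including `1` makes the norm estimate the case `s = 1` of the correlation estimate.
  obtain ⟨n, κ, _, S, η, C, Q, hS, hQπ, hQ⟩ := exists_coefficient_operators hnuc (insert 1 F) hδ
  have hcorr : ∀ s ∈ insert 1 F, ∀ x, |(∑ g ∈ S, inner ℂ (coefficientVector η C (z (s * x)) g)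
      (coefficientVector η C (z x) (s⁻¹ * g))).re - 1| ≤ δ := by
    intro s hs x
    have h2 : inner ℂ (z (s * x)) (π (LeftRegular.unitary s) (z x)) = 1 := by
      rw [hzmul, inner_self_eq_norm_sq_to_K, hz1]
      simp
    have h3 : inner ℂ (z (s * x)) (Q s (z x)) - 1 =
        inner ℂ (z (s * x)) ((Q s - π (LeftRegular.unitary s)) (z x)) := by
      rw [sub_apply, inner_sub_right, h2]
    calc _ = |(inner ℂ (z (s * x)) ((Q s - π (LeftRegular.unitary s)) (z x))).re| := by
          rw [hQ, ← h3, Complex.sub_re, Complex.one_re]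
      _ ≤ ‖inner ℂ (z (s * x)) ((Q s - π (LeftRegular.unitary s)) (z x))‖ :=
          Complex.abs_re_le_norm _
      _ ≤ ‖z (s * x)‖ * ‖(Q s - π (LeftRegular.unitary s)) (z x)‖ := norm_inner_le_norm _ _
      _ ≤ 1 * (δ * 1) := by
          rw [hz1]
          gcongr
          refine (ContinuousLinearMap.le_opNorm _ _).trans ?_
          rw [hz1]
          gcongr
          exact hQπ s hs
      _ = δ := by ring
  have hsupp : ∀ x, ∀ g ∉ S, coefficientVector η C (z x) g = 0 :=
    fun x g hg => coefficientVector_eq_zero hS C (z x) hg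
  have hnorm : ∀ x, |∑ g ∈ S, ‖coefficientVector η C (z x) g‖ ^ 2 - 1| ≤ δ := by
    intro x
    have := hcorr 1 (Finset.mem_insert_self _ _) x
    simp only [inv_one, one_mul, Complex.re_sum] at this
    convert this using 4
    exact norm_sq_eq_re_inner (𝕜 := ℂ) _
  exact ⟨_, inferInstance, S, fun x => coefficientVector η C (z x), hsupp, hnorm, fun s hs x T =>
    sum_norm_sub_sq_le hsupp hnorm (hcorr s (Finset.mem_insert_of_mem hs) x) T⟩

end ExactGroup

theorem hasFiniteApproxMeans_of_isExactGroup {G : Type u} [Group G] (hG : IsExactGroup G) :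
    HasFiniteApproxMeans G := by
  let _ : PartialOrder (reducedGroupCStarAlgebra G) := CStarAlgebra.spectralOrder _
  have : StarOrderedRing (reducedGroupCStarAlgebra G) := CStarAlgebra.spectralOrderedRing _
  obtain ⟨H, _, _, _, π, hπ, hnuc⟩ := hG
  have hne : π 1 ≠ 0 := by
    rw [Ne, ← map_zero π]
    intro h
    classical
    have h1 := congrArg (fun T : reducedGroupCStarAlgebra G =>
      (T : lp (fun _ : G => ℂ) 2 →L[ℂ] lp (fun _ : G => ℂ) 2) (lp.single 2 1 1) 1) (hπ h)
    simp at h1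
  refine hasFiniteApproxMeans_of_vectors fun F δ hδ => ?_
  -- The first bound keeps the masses within `1/2` of `1`; the second turns the displacement bound
  -- `4 * δ'` into `δ ^ 2`.
  have hδ' : 0 < min (1 / 2) (δ ^ 2 / 4) := by positivity
  obtain ⟨V, _, S, a, hS, h1, h2⟩ := exists_vectors_of_isNuclearMap hne hnuc F hδ'
  refine ⟨V, inferInstance, S, a, hS, fun x => (h1 x).trans (min_le_left _ _), fun s hs x T =>
    (h2 s hs x T).trans ?_⟩
  linarith [min_le_right (1 / 2) (δ ^ 2 / 4)]

theorem corollary8p3 (G : Type u) [Group G] [Countable G] [Infinite G] :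
    ∃ (X : Type u) (_ : TopologicalSpace X) (_ : MulAction G X),
      ContinuousConstSMul G X ∧
      LocallyCompactSpace X ∧
      T2Space X ∧
      TotallyDisconnectedSpace X ∧
      ¬ DiscreteTopology X ∧
      ¬ CompactSpace X ∧
      (∀ (g : G) (x : X), g • x = x → g = 1) ∧
      MulAction.IsMinimal G X ∧
      (IsExactGroup G → IsAmenableAction G X) := by
  obtain ⟨Z, hinv, hlc, hdisc, hcomp, hmin⟩ := exists_minimal_invariant_ultrafilters G
  let X : SubMulAction G (Ultrafilter G) := ⟨Z, fun g z hz => hinv g z hz⟩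
  refine ⟨X, inferInstance, inferInstance, ⟨fun g => ?_⟩, hlc.locallyCompactSpace, inferInstance,
    inferInstanceAs (TotallyDisconnectedSpace Z), hdisc,
    fun h => hcomp (isCompact_iff_compactSpace.2 h), fun g x h => ?_, ⟨fun x => ?_⟩, fun hG => ?_⟩
  · exact ((continuous_const_smul g).comp continuous_subtype_val).subtype_mk _
  · exact eq_one_of_smul_ultrafilter_eq (congrArg Subtype.val h)
  · intro y
    rw [closure_subtype]
    refine closure_mono ?_ (hmin x.1 x.2 y.2)
    rintro _ ⟨g, rfl⟩
    exact ⟨g • x, ⟨g, rfl⟩, rfl⟩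
  · exact isAmenableAction_of_equivariant (hasFiniteApproxMeans_of_isExactGroup hG) Subtype.val
      continuous_subtype_val fun _ _ => rfl
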